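/- Let $m\ge 0$ and $n\ge 1$ be integers and let $s$ be a real number with $2m<s<n$. Let $G(n,m)$ be the Grassmannian of $m$-dimensional linear subspaces of $\mathbb{R}^n$, and let $\gamma_{n,m}$ be the rotation-invariant (Haar) Borel probability measure on $G(n,m)$, that is, the image of the normalized Haar measure of the orthogonal group $O(n)$ under $g\mapsto gV_0$, where $V_0\in G(n,m)$ is a fixed subspace. For $V\in G(n,m)$ let $P_V\colon\mathbb{R}^n\to V$ be the orthogonal projection. Let $\mu$ be a Borel measure on $\mathbb{R}^n$ with $0<\mu(\mathbb{R}^n)<\infty$, with compact support $\operatorname{spt}\mu$, and with finite $s$-energy $$I_s(\mu)=\iint |x-y|^{-s}\,d\mu(x)\,d\mu(y)<\infty .$$ Then $$\gamma_{n,m}\bigl(\{V\in G(n,m): 0\in\operatorname{Int}(P_V(\operatorname{spt}\mu))\}\bigr)>0,$$ where $\operatorname{Int}$ denotes the interior relative to $V$. -/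

import Mathlib

open MeasureTheory

noncomputable section

namespace RieszProj

/-- Euclidean space `ℝⁿ`. -/
abbrev E (n : ℕ) : Type := EuclideanSpace ℝ (Fin n)

/-- The `s`-energy `I_s(μ) = ∬ |x - y|^{-s} dμ(x) dμ(y)`, an element of `[0, ∞]`;
for `s > 0` the kernel is `∞` on the diagonal. -/
def energy {n : ℕ} (s : ℝ) (μ : Measure (E n)) : ENNReal :=
  ∫⁻ x, ∫⁻ y, edist x y ^ (-s) ∂μ ∂μ

/-- `G(n,m)`: the `m`-dimensional linear subspaces of `ℝⁿ`. -/
def Gr (n m : ℕ) : Type := {V : Submodule ℝ (E n) // Module.finrank ℝ V = m}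

/-- The usual topology of `G(n,m)`, given by the metric `‖P_V - P_W‖`. -/
instance (n m : ℕ) : TopologicalSpace (Gr n m) :=
  TopologicalSpace.induced (fun V => V.1.starProjection) inferInstance

instance (n m : ℕ) : MeasurableSpace (Gr n m) := borel _

instance (n m : ℕ) : BorelSpace (Gr n m) := ⟨rfl⟩

/-- The orthogonal group `O(n)`, with its topology as a set of matrices. -/
abbrev O (n : ℕ) := Matrix.orthogonalGroup (Fin n) ℝ

instance (n : ℕ) : MeasurableSpace (O n) := borel _

instance (n : ℕ) : BorelSpace (O n) := ⟨rfl⟩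

instance (n : ℕ) : CompactSpace (O n) := by
  refine (isCompact_iff_compactSpace
    (s := (Matrix.orthogonalGroup (Fin n) ℝ : Set (Matrix (Fin n) (Fin n) ℝ)))).mp ?_
  have hK : IsCompact (Set.pi Set.univ fun _ : Fin n =>
      Set.pi Set.univ fun _ : Fin n => Set.Icc (-1 : ℝ) 1) :=
    isCompact_univ_pi fun _ => isCompact_univ_pi fun _ => isCompact_Icc
  refine hK.of_isClosed_subset ?_ ?_
  · have h : ((Matrix.orthogonalGroup (Fin n) ℝ : Set (Matrix (Fin n) (Fin n) ℝ)))
        = {A | A * star A = 1} := by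
      ext A; exact Matrix.mem_unitaryGroup_iff
    exact h ▸ isClosed_eq (by fun_prop) continuous_const
  · intro A hA i _ j _
    have h := entry_norm_bound_of_unitary hA i j
    rw [Real.norm_eq_abs] at h
    exact abs_le.mp h

/-- The normalized Haar measure `θ_n` of `O(n)`. -/
def haarO (n : ℕ) : Measure (O n) := Measure.haarMeasure ⊤

instance (n : ℕ) : IsProbabilityMeasure (haarO n) :=
  ⟨Measure.haarMeasure_self (K₀ := (⊤ : TopologicalSpace.PositiveCompacts (O n)))⟩

/-- The image `gV` of the subspace `V` under `g ∈ O(n)`. -/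
def rotate {n : ℕ} (g : O n) (V : Submodule ℝ (E n)) : Submodule ℝ (E n) :=
  V.map (Matrix.toEuclideanLin (g : Matrix (Fin n) (Fin n) ℝ))

theorem toEuclideanLin_injective {n : ℕ} (g : O n) :
    Function.Injective (Matrix.toEuclideanLin (g : Matrix (Fin n) (Fin n) ℝ)) := by
  intro x y h
  have h1 : (g : Matrix (Fin n) (Fin n) ℝ).mulVec x.ofLp
      = (g : Matrix (Fin n) (Fin n) ℝ).mulVec y.ofLp := congrArg WithLp.ofLp h
  have h2 := congrArg (star (g : Matrix (Fin n) (Fin n) ℝ)).mulVec h1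
  rw [Matrix.mulVec_mulVec, Matrix.mulVec_mulVec, Unitary.coe_star_mul_self,
    Matrix.one_mulVec, Matrix.one_mulVec] at h2
  exact WithLp.ofLp_injective 2 h2

/-- The action of `g ∈ O(n)` on `G(n,m)`. -/
def Gr.rotate {n m : ℕ} (g : O n) (V : Gr n m) : Gr n m :=
  ⟨RieszProj.rotate g V.1,
    (Submodule.equivMapOfInjective _ (toEuclideanLin_injective g) V.1).finrank_eq.symm.trans V.2⟩

/-- The coordinate subspace `V₀ = span {e_1, …, e_m}` of `ℝⁿ`, for `m ≤ n`. -/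
def Gr.base {n m : ℕ} (h : m ≤ n) : Gr n m :=
  ⟨Submodule.span ℝ (Set.range fun i : Fin m =>
      EuclideanSpace.single (Fin.castLE h i) (1 : ℝ)), by
    have hl : LinearIndependent ℝ fun i : Fin m =>
        (EuclideanSpace.single (Fin.castLE h i) (1 : ℝ) : E n) := by
      have := (EuclideanSpace.orthonormal_single (𝕜 := ℝ) (ι := Fin n)).comp
        _ (Fin.castLE_injective h)
      exact this.linearIndependent
    rw [finrank_span_eq_card hl, Fintype.card_fin]⟩

theorem starProjection_map_of_unitary {n : ℕ} (A B : E n →L[ℝ] E n)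
    (hB : B = ContinuousLinearMap.adjoint A) (h1 : A * B = 1) (h2 : B * A = 1)
    (V : Submodule ℝ (E n)) :
    (V.map (A : E n →ₗ[ℝ] E n)).starProjection = A.comp (V.starProjection.comp B) := by
  ext1 x
  refine Submodule.eq_starProjection_of_mem_of_inner_eq_zero
    (Submodule.mem_map_of_mem (Submodule.starProjection_apply_mem _ _)) ?_
  rintro _ ⟨w, hw, rfl⟩
  have hx : A (B x) = x := DFunLike.congr_fun h1 x
  have h2' : ∀ z, B (A z) = z := fun z => DFunLike.congr_fun h2 z
  change inner ℝ (x - A (V.starProjection (B x))) (A w) = 0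
  rw [← ContinuousLinearMap.adjoint_inner_left, ← hB, map_sub, h2']
  exact Submodule.starProjection_inner_eq_zero _ _ hw

/-- `g ↦ gV` is continuous, since `P_{gV} = g P_V g⁻¹`; so the image measure below makes sense. -/
theorem Gr.continuous_rotate {n m : ℕ} (V : Gr n m) : Continuous fun g : O n => Gr.rotate g V := by
  rw [continuous_induced_rng]
  let T : Matrix (Fin n) (Fin n) ℝ →ₗ[ℝ] (E n →L[ℝ] E n) :=
    (Matrix.toEuclideanCLM (n := Fin n) (𝕜 := ℝ)).toAlgEquiv.toLinearMap
  have hT : Continuous T := T.continuous_of_finiteDimensional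
  have hmul : ∀ A B, T (A * B) = T A * T B :=
    map_mul (Matrix.toEuclideanCLM (n := Fin n) (𝕜 := ℝ))
  have hone : T 1 = 1 := map_one (Matrix.toEuclideanCLM (n := Fin n) (𝕜 := ℝ))
  have hstar : ∀ A, T (star A) = ContinuousLinearMap.adjoint (T A) :=
    map_star (Matrix.toEuclideanCLM (n := Fin n) (𝕜 := ℝ))
  have h1 : Continuous fun g : O n => T g.1 := hT.comp continuous_subtype_val
  have h2 : Continuous fun g : O n => T (star g.1) := hT.comp continuous_subtype_val.star
  refine (h1.clm_comp ((continuous_const (y := V.1.starProjection)).clm_comp h2)).congr fun g => ?_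
  exact (starProjection_map_of_unitary (T g.1) (T (star g.1)) (hstar _)
    (by rw [← hmul, Unitary.mul_star_self_of_mem g.2, hone])
    (by rw [← hmul, Unitary.star_mul_self_of_mem g.2, hone]) V.1).symm

/-- The rotation-invariant probability measure `γ_{n,m}` on `G(n,m)`: the image of the normalized
Haar measure of `O(n)` under `g ↦ g V₀`. For `m > n`, where `G(n,m)` is empty, it is `0`. -/
def gammaGr (n m : ℕ) : Measure (Gr n m) :=
  if h : m ≤ n then (haarO n).map fun g => Gr.rotate g (Gr.base h) else 0

theorem isProbabilityMeasure_gammaGr {n m : ℕ} (h : m ≤ n) :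
    IsProbabilityMeasure (gammaGr n m) := by
  rw [gammaGr, dif_pos h]
  exact Measure.isProbabilityMeasure_map (Gr.continuous_rotate _).measurable.aemeasurable

end RieszProj

end

/-!
Let `T : F → ℝⁿ` be a linear isometry from an `m`-dimensional space, `m > 0`. Polar coordinates turn
the average of `∫_F charFun μ (g (T u)) du` over `g ∈ O(n)` into a positive multiple of
`∫ |ξ|^{m-n} charFun μ ξ dξ`.

* This integral converges absolutely. Near the origin `charFun μ` is bounded; far from it,
  `2 |charFun μ| |ξ|^{m-n} ≤ |charFun μ|² |ξ|^{s-n} + |ξ|^{2m-s-n}`, where the first term is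
  integrable because its integral is a multiple of `I_s(μ)`, and the second because `2m < s`.
* It is positive, being formally a positive multiple of `∫ |x|^{-m} dμ x`. Writing `|ξ|^{m-n}` as a
  superposition of the Gaussians `exp (-|ξ|² / t)` makes this rigorous, since against each of them
  `charFun μ` has a positive integral.

So for a set of `g` of positive measure, the function `charFun μ ∘ g ∘ T` on `F` is integrable with
nonzero integral. It is the characteristic function of the image of `μ` under the projection to
`g (T F)`; by Fourier inversion that image has a continuous density which does not vanish at `0`,
whence `0` is interior to the projection of the support.

The case of a `μ` that is neither finite nor compactly supported reduces to this one: finite energy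
makes `μ` locally finite, and `μ` may be replaced by its restriction to a ball around a point of its
support.
-/

namespace RieszProj

open Filter Metric Module Set Topology

section Radial

variable {V : Type*} [NormedAddCommGroup V] [NormedSpace ℝ V] [FiniteDimensional ℝ V]
  [MeasurableSpace V] [BorelSpace V] (μ : Measure V) [μ.IsAddHaarMeasure]

theorem lintegral_comp_norm [Nontrivial V] {f : ℝ → ENNReal} (hf : Measurable f) :
    ∫⁻ x, f ‖x‖ ∂μ =
      μ.toSphere univ * ∫⁻ r in Ioi (0 : ℝ), ENNReal.ofReal (r ^ (finrank ℝ V - 1)) * f r := by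
  calc
    ∫⁻ x, f ‖x‖ ∂μ = ∫⁻ x : ({(0)}ᶜ : Set V), f ‖x.1‖ ∂(μ.comap (↑)) := by
      rw [lintegral_subtype_comap (measurableSet_singleton _).compl fun x : V ↦ f ‖x‖,
        restrict_compl_singleton]
    _ = ∫⁻ x : sphere (0 : V) 1 × Ioi (0 : ℝ), f x.2
          ∂μ.toSphere.prod (.volumeIoiPow (finrank ℝ V - 1)) := by
      simpa using μ.measurePreserving_homeomorphUnitSphereProd.lintegral_comp_emb
        (Homeomorph.measurableEmbedding _) fun x => f x.2
    _ = μ.toSphere univ * ∫⁻ r : Ioi (0 : ℝ), f r ∂.volumeIoiPow (finrank ℝ V - 1) := by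
      rw [lintegral_prod _ (by fun_prop)]
      simp [mul_comm]
    _ = _ := by
      rw [Measure.volumeIoiPow, lintegral_withDensity_eq_lintegral_mul _ (by fun_prop)
        (by fun_prop)]
      congr 1
      exact lintegral_subtype_comap measurableSet_Ioi
        fun r : ℝ => ENNReal.ofReal (r ^ (finrank ℝ V - 1)) * f r

theorem integrableOn_ball_norm_rpow [Nontrivial V] {a : ℝ} (ha : -(finrank ℝ V : ℝ) < a) :
    IntegrableOn (fun x => ‖x‖ ^ a) (ball 0 1) μ := by
  rw [integrableOn_fun_norm_addHaar μ (f := fun r => r ^ a)]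
  have hpow : IntegrableOn (fun r : ℝ => r ^ (finrank ℝ V - 1 + a)) (Ioo 0 1) :=
    ((intervalIntegrable_iff_integrableOn_Ioo_of_le zero_le_one).1
      (intervalIntegral.intervalIntegrable_rpow' (by linarith)))
  refine hpow.congr_fun (fun r hr => ?_) measurableSet_Ioo
  dsimp only
  rw [smul_eq_mul, Real.rpow_add hr.1, ← Nat.cast_pred finrank_pos, Real.rpow_natCast]

theorem integrableOn_compl_ball_norm_rpow {a : ℝ} (ha : a < -(finrank ℝ V : ℝ)) :
    IntegrableOn (fun x => ‖x‖ ^ a) (ball 0 1)ᶜ μ := by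
  have hdecay : Integrable (fun x : V => (2 : ℝ) ^ (-a) * (1 + ‖x‖) ^ a) μ := by
    simpa using (integrable_one_add_norm (μ := μ) (lt_neg_of_lt_neg ha)).const_mul (2 ^ (-a))
  refine hdecay.integrableOn.mono' (Measurable.aestronglyMeasurable (by fun_prop)) ?_
  filter_upwards [ae_restrict_mem measurableSet_ball.compl] with x hx
  have hx1 : 1 ≤ ‖x‖ := by simpa using hx
  have hcmp : (2 * ‖x‖) ^ a ≤ (1 + ‖x‖) ^ a :=
    Real.rpow_le_rpow_of_nonpos (by positivity) (by linarith)
      (ha.le.trans (neg_nonpos.2 (Nat.cast_nonneg _)))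
  rw [Real.norm_of_nonneg (by positivity)]
  calc ‖x‖ ^ a = 2 ^ (-a) * (2 * ‖x‖) ^ a := by
        rw [Real.mul_rpow zero_le_two (norm_nonneg x), ← mul_assoc,
          ← Real.rpow_add zero_lt_two, neg_add_cancel, Real.rpow_zero, one_mul]
    _ ≤ 2 ^ (-a) * (1 + ‖x‖) ^ a := by gcongr

theorem toSphere_univ_ne_zero [Nontrivial V] : μ.toSphere univ ≠ 0 :=
  Measure.measure_univ_ne_zero.2 (Measure.toSphere_ne_zero μ)

end Radial

section GammaIntegrals

variable {a r : ℝ}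

theorem integrableOn_rpow_mul_exp_neg_mul (ha : 0 < a) (hr : 0 < r) :
    IntegrableOn (fun t : ℝ => t ^ (a - 1) * Real.exp (-(r * t))) (Ioi 0) := by
  refine Integrable.of_integral_ne_zero ?_
  rw [Real.integral_rpow_mul_exp_neg_mul_Ioi ha hr]
  positivity

theorem integral_rpow_mul_exp_neg_div (ha : 0 < a) (hr : 0 < r) :
    ∫ t in Ioi (0 : ℝ), t ^ (-a - 1) * Real.exp (-(r / t)) = (1 / r) ^ a * Real.Gamma a := by
  rw [← Real.integral_rpow_mul_exp_neg_mul_Ioi ha hr,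
    ← integral_comp_rpow_Ioi _ (neg_ne_zero.2 one_ne_zero)]
  refine setIntegral_congr_fun measurableSet_Ioi fun t ht => ?_
  have ht0 : 0 < t := ht
  rw [abs_neg, abs_one, one_mul, smul_eq_mul, ← mul_assoc, ← Real.rpow_mul ht0.le,
    ← Real.rpow_add ht0, Real.rpow_neg_one, div_eq_mul_inv, inv_inv]
  ring_nf

theorem integrableOn_rpow_mul_exp_neg_div (ha : 0 < a) (hr : 0 < r) :
    IntegrableOn (fun t : ℝ => t ^ (-a - 1) * Real.exp (-(r / t))) (Ioi 0) := by
  refine Integrable.of_integral_ne_zero ?_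
  rw [integral_rpow_mul_exp_neg_div ha hr]
  positivity

theorem one_div_sq_rpow_half (hr : 0 < r) : (1 / r ^ 2) ^ (a / 2) = r ^ (-a) := by
  rw [one_div, Real.inv_rpow (by positivity), ← Real.rpow_natCast, ← Real.rpow_mul hr.le,
    ← Real.rpow_neg hr.le, Nat.cast_ofNat, mul_div_cancel₀ _ two_ne_zero]

theorem mul_rpow_add_half_le (hr : 0 < r) (x p q : ℝ) :
    x * r ^ ((p + q) / 2) ≤ x ^ 2 * r ^ p + r ^ q := by
  have hsq (b : ℝ) : r ^ b = (r ^ (b / 2)) ^ 2 := by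
    rw [← Real.rpow_natCast, ← Real.rpow_mul hr.le, Nat.cast_ofNat, div_mul_cancel₀ _ two_ne_zero]
  rw [add_div, Real.rpow_add hr, hsq p, hsq q]
  nlinarith [sq_nonneg (x * r ^ (p / 2) - r ^ (q / 2)), sq_nonneg (x * r ^ (p / 2)),
    sq_nonneg (r ^ (q / 2))]

end GammaIntegrals

section Gaussian

variable {V : Type*} [NormedAddCommGroup V] [MeasurableSpace V] [BorelSpace V] (ν : Measure V)

theorem integrable_exp_neg_norm_sq_mul [IsFiniteMeasure ν] {t : ℝ} (ht : 0 ≤ t) :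
    Integrable (fun y => Real.exp (-(‖y‖ ^ 2 / 4 * t))) ν := by
  refine (integrable_const (1 : ℝ)).mono' (by fun_prop) (ae_of_all _ fun y => ?_)
  rw [Real.norm_of_nonneg (Real.exp_nonneg _), Real.exp_le_one_iff, neg_nonpos]
  positivity

variable [InnerProductSpace ℝ V]

/-- The pairing of `charFun ν` with the Gaussian `ξ ↦ exp (-‖ξ‖² / t)`, computed on the side of
`ν` by Parseval's formula; see `integral_charFun_mul_exp_neg_div`. As a function of `t → ∞` it is
the Gauss summation of the Fourier inversion integral of `ν` at the origin. -/
noncomputable def gaussianMean (t : ℝ) : ℝ :=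
  (Real.pi * t) ^ (finrank ℝ V / 2 : ℝ) * ∫ y, Real.exp (-(‖y‖ ^ 2 / 4 * t)) ∂ν

variable [IsFiniteMeasure ν]

theorem gaussianMean_pos [NeZero ν] {t : ℝ} (ht : 0 < t) : 0 < gaussianMean ν t := by
  have := integral_exp_pos (integrable_exp_neg_norm_sq_mul ν ht.le)
  rw [gaussianMean]
  positivity

variable {ν} in
theorem tendsto_gaussianMean_zero {δ : ℝ} (hδ : 0 < δ) (hball : ν (ball 0 δ) = 0) :
    Tendsto (gaussianMean ν) atTop (𝓝 0) := by
  set d : ℝ := finrank ℝ V / 2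
  have hdecay : Tendsto (fun t : ℝ => Real.pi ^ d * ν.real univ *
      (t ^ d * Real.exp (-(δ ^ 2 / 4) * t))) atTop (𝓝 0) := by
    simpa using (tendsto_rpow_mul_exp_neg_mul_atTop_nhds_zero d (δ ^ 2 / 4)
      (by positivity)).const_mul (Real.pi ^ d * ν.real univ)
  refine squeeze_zero_norm' ?_ hdecay
  filter_upwards [eventually_gt_atTop 0] with t ht
  have hmass : ∫ y, Real.exp (-(‖y‖ ^ 2 / 4 * t)) ∂ν ≤
      ν.real univ * Real.exp (-(δ ^ 2 / 4) * t) := by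
    rw [← smul_eq_mul, ← integral_const]
    refine integral_mono_ae (integrable_exp_neg_norm_sq_mul ν ht.le) (integrable_const _) ?_
    filter_upwards [measure_eq_zero_iff_ae_notMem.1 hball] with y hy
    rw [mem_ball_zero_iff, not_lt] at hy
    rw [neg_mul]
    gcongr
  rw [gaussianMean, Real.norm_of_nonneg (by positivity)]
  calc _ ≤ (Real.pi * t) ^ d * (ν.real univ * Real.exp (-(δ ^ 2 / 4) * t)) := by gcongr
    _ = _ := by rw [Real.mul_rpow Real.pi_pos.le ht.le]; ring

variable [FiniteDimensional ℝ V]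

variable (V) in
theorem integrable_exp_neg_norm_sq_div {t : ℝ} (ht : 0 < t) :
    Integrable fun ξ : V => Real.exp (-(‖ξ‖ ^ 2 / t)) := by
  have h := GaussianFourier.integral_rexp_neg_mul_sq_norm (V := V) (inv_pos.2 ht)
  refine Integrable.of_integral_ne_zero ?_
  simp_rw [neg_mul, mul_comm t⁻¹, ← div_eq_mul_inv] at h
  rw [h]
  positivity

theorem integral_charFun_mul_exp_neg_div {t : ℝ} (ht : 0 < t) :
    ∫ ξ, charFun ν ξ * (Real.exp (-(‖ξ‖ ^ 2 / t)) : ℝ) = (gaussianMean ν t : ℂ) := by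
  let F (ξ y : V) : ℂ :=
    Complex.exp ((inner ℝ y ξ : ℝ) * Complex.I) * (Real.exp (-(‖ξ‖ ^ 2 / t)) : ℝ)
  have hgauss (y : V) : ∫ ξ, F ξ y =
      (((Real.pi * t) ^ (finrank ℝ V / 2 : ℝ) * Real.exp (-(‖y‖ ^ 2 / 4 * t)) : ℝ) : ℂ) := by
    have hF (ξ : V) : F ξ y =
        Complex.exp (-(t⁻¹ : ℝ) * ‖ξ‖ ^ 2 + Complex.I * (inner ℝ y ξ : ℝ)) := by
      simp only [F]
      rw [Complex.ofReal_exp, ← Complex.exp_add]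
      congr 1
      push_cast
      ring
    simp_rw [hF]
    rw [GaussianFourier.integral_cexp_neg_mul_sq_norm_add (by simpa using ht), Complex.ofReal_mul,
      Complex.ofReal_cpow (by positivity), Complex.ofReal_exp, Complex.I_sq]
    congr 2
    · push_cast; rw [div_inv_eq_mul]
    · push_cast; ring
    · push_cast; field_simp
  have hint : Integrable (Function.uncurry F) (volume.prod ν) := by
    have hbound : Integrable (fun p : V × V => Real.exp (-(‖p.1‖ ^ 2 / t))) (volume.prod ν) := by
      simpa using (integrable_exp_neg_norm_sq_div V ht).mul_prod (integrable_const (μ := ν) (1 : ℝ))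
    refine hbound.mono' (Measurable.aestronglyMeasurable (by fun_prop)) (ae_of_all _ fun p => ?_)
    simp only [Function.uncurry, F]
    rw [norm_mul, Complex.norm_exp_ofReal_mul_I, one_mul, Complex.norm_real,
      Real.norm_of_nonneg (Real.exp_nonneg _)]
  simp_rw [charFun_apply, ← integral_mul_const]
  rw [integral_integral_swap hint]
  simp_rw [hgauss]
  rw [integral_complex_ofReal, integral_const_mul, gaussianMean]

variable {ν}

theorem tendsto_gaussianMean_integral_charFun (hν : Integrable (charFun ν)) :
    Tendsto (fun t => (gaussianMean ν t : ℂ)) atTop (𝓝 (∫ ξ, charFun ν ξ)) := by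
  have hlim : Tendsto (fun t : ℝ => ∫ ξ, charFun ν ξ * (Real.exp (-(‖ξ‖ ^ 2 / t)) : ℝ)) atTop
      (𝓝 (∫ ξ, charFun ν ξ)) := by
    refine tendsto_integral_filter_of_dominated_convergence (fun ξ => ‖charFun ν ξ‖)
      (Eventually.of_forall fun t => Measurable.aestronglyMeasurable (by fun_prop)) ?_ hν.norm
      (ae_of_all _ fun ξ => ?_)
    · filter_upwards [eventually_gt_atTop 0] with t ht
      refine ae_of_all _ fun ξ => ?_
      rw [norm_mul, Complex.norm_real, Real.norm_of_nonneg (Real.exp_nonneg _)]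
      exact mul_le_of_le_one_right (norm_nonneg _)
        (Real.exp_le_one_iff.2 (neg_nonpos.2 (by positivity)))
    · have hexp : Tendsto (fun t : ℝ => Real.exp (-(‖ξ‖ ^ 2 / t))) atTop (𝓝 1) := by
        simpa using (tendsto_const_nhds.div_atTop tendsto_id).neg.rexp
      simpa using (Complex.continuous_ofReal.tendsto' 1 1 rfl |>.comp hexp).const_mul (charFun ν ξ)
  refine hlim.congr' ?_
  filter_upwards [eventually_gt_atTop 0] with t ht using integral_charFun_mul_exp_neg_div ν ht

theorem integral_charFun_eq_zero_of_measure_ball_eq_zero (hν : Integrable (charFun ν)) {δ : ℝ}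
    (hδ : 0 < δ) (hball : ν (ball 0 δ) = 0) : ∫ ξ, charFun ν ξ = 0 :=
  tendsto_nhds_unique (tendsto_gaussianMean_integral_charFun hν)
    (Complex.continuous_ofReal.tendsto' 0 0 rfl |>.comp (tendsto_gaussianMean_zero hδ hball))

theorem continuous_integral_charFun_map_add_const (hν : Integrable (charFun ν)) :
    Continuous fun x => ∫ ξ, charFun (ν.map (· + x)) ξ := by
  simp_rw [charFun_map_add_const]
  refine continuous_of_dominated (bound := fun ξ => ‖charFun ν ξ‖)
    (fun x => Measurable.aestronglyMeasurable (by fun_prop)) (fun x => ae_of_all _ fun ξ => ?_)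
    hν.norm (ae_of_all _ fun ξ => by fun_prop)
  rw [norm_mul, Complex.norm_exp_ofReal_mul_I, mul_one]

theorem integrable_charFun_map_add_const (hν : Integrable (charFun ν)) (x : V) :
    Integrable (charFun (ν.map (· + x))) := by
  refine hν.norm.mono' (Measurable.aestronglyMeasurable (by fun_prop)) (ae_of_all _ fun ξ => ?_)
  rw [charFun_map_add_const, norm_mul, Complex.norm_exp_ofReal_mul_I, mul_one]

/- `∫ charFun ν` is, up to a constant, the value at `0` of the continuous density of `ν`. -/
theorem zero_mem_interior_of_integral_charFun_ne_zero (hν : Integrable (charFun ν))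
    (hne : ∫ ξ, charFun ν ξ ≠ 0) {K : Set V} (hK : IsClosed K) (hνK : ν Kᶜ = 0) :
    (0 : V) ∈ interior K := by
  have hcont : ContinuousAt (fun x => ∫ ξ, charFun (ν.map (· + -x)) ξ) 0 :=
    ((continuous_integral_charFun_map_add_const hν).comp continuous_neg).continuousAt
  rw [mem_interior_iff_mem_nhds]
  filter_upwards [hcont.eventually_ne (y := 0) (by simpa using hne)] with x hx
  by_contra hxK
  obtain ⟨δ, hδ, hball⟩ := isOpen_iff.1 hK.isOpen_compl x hxK
  refine hx (integral_charFun_eq_zero_of_measure_ball_eq_zero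
    (integrable_charFun_map_add_const hν (-x)) hδ ?_)
  rw [Measure.map_apply (by fun_prop) measurableSet_ball]
  refine measure_mono_null (fun y hy => hball ?_) hνK
  simpa [dist_eq_norm, sub_eq_add_neg] using hy

end Gaussian

section RieszKernel

variable {V : Type*} [NormedAddCommGroup V]

theorem lintegral_rpow_mul_exp_neg_norm_sq {k : ℝ} (hk : 0 < k) (y : V) :
    ∫⁻ t in Ioi (0 : ℝ), ENNReal.ofReal (t ^ (k / 2 - 1) * Real.exp (-(‖y‖ ^ 2 / 4 * t))) =
      ENNReal.ofReal (2 ^ k * Real.Gamma (k / 2)) * ‖y‖ₑ ^ (-k) := by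
  have hnonneg (c : ℝ) :
      ∀ᵐ t ∂volume.restrict (Ioi (0 : ℝ)), 0 ≤ t ^ (k / 2 - 1) * Real.exp (-(c * t)) := by
    filter_upwards [ae_restrict_mem measurableSet_Ioi] with t ht
    have ht0 : 0 < t := ht
    positivity
  rcases eq_or_ne y 0 with rfl | hy
  · have hdiv : ∫⁻ t in Ioi (0 : ℝ), ENNReal.ofReal (t ^ (k / 2 - 1)) = ⊤ := by
      by_contra h
      refine not_integrableOn_Ioi_rpow (k / 2 - 1) ((lintegral_ofReal_ne_top_iff_integrable
        (Measurable.aestronglyMeasurable (by fun_prop)) ?_).1 h)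
      filter_upwards [hnonneg 0] with t ht using by simpa using ht
    have hconst : 0 < 2 ^ k * Real.Gamma (k / 2) := by positivity
    simp [hdiv, ENNReal.zero_rpow_of_neg (neg_lt_zero.2 hk),
      ENNReal.mul_top (ENNReal.ofReal_pos.2 hconst).ne']
  · have hr : 0 < ‖y‖ / 2 := half_pos (norm_pos_iff.2 hy)
    rw [show ‖y‖ ^ 2 / 4 = (‖y‖ / 2) ^ 2 by ring, ← ofReal_integral_eq_lintegral_ofReal
        (integrableOn_rpow_mul_exp_neg_mul (half_pos hk) (by positivity)) (hnonneg _),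
      Real.integral_rpow_mul_exp_neg_mul_Ioi (half_pos hk) (by positivity),
      one_div_sq_rpow_half hr, ← ofReal_norm, ENNReal.ofReal_rpow_of_pos (norm_pos_iff.2 hy),
      ← ENNReal.ofReal_mul (by positivity), Real.div_rpow (norm_nonneg y) zero_le_two,
      Real.rpow_neg zero_le_two, div_inv_eq_mul]
    ring_nf

variable [InnerProductSpace ℝ V] [MeasurableSpace V] [BorelSpace V]
  (ν : Measure V) [IsFiniteMeasure ν]

theorem lintegral_rpow_mul_gaussianMean {k : ℝ} (hk : 0 < k) :
    ∫⁻ t in Ioi (0 : ℝ),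
        ENNReal.ofReal (t ^ (-((finrank ℝ V - k) / 2) - 1) * gaussianMean ν t) =
      ENNReal.ofReal (Real.pi ^ (finrank ℝ V / 2 : ℝ) * (2 ^ k * Real.Gamma (k / 2))) *
        ∫⁻ y, ‖y‖ₑ ^ (-k) ∂ν := by
  set d := (finrank ℝ V : ℝ)
  have hslice (t : ℝ) (ht : t ∈ Ioi (0 : ℝ)) :
      ENNReal.ofReal (t ^ (-((d - k) / 2) - 1) * gaussianMean ν t) =
        ENNReal.ofReal (Real.pi ^ (d / 2)) *
          ∫⁻ y, ENNReal.ofReal (t ^ (k / 2 - 1) * Real.exp (-(‖y‖ ^ 2 / 4 * t))) ∂ν := by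
    have ht0 : 0 < t := ht
    have hpow : t ^ (-((d - k) / 2) - 1) * (Real.pi * t) ^ (d / 2) =
        Real.pi ^ (d / 2) * t ^ (k / 2 - 1) := by
      rw [Real.mul_rpow Real.pi_pos.le ht0.le, mul_left_comm, ← Real.rpow_add ht0]
      ring_nf
    rw [gaussianMean, ← mul_assoc, hpow, mul_assoc, ENNReal.ofReal_mul (by positivity),
      ← integral_const_mul, ofReal_integral_eq_lintegral_ofReal
        ((integrable_exp_neg_norm_sq_mul ν ht0.le).const_mul _)
        (ae_of_all _ fun y => by positivity)]
  rw [setLIntegral_congr_fun measurableSet_Ioi hslice,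
    lintegral_const_mul' _ _ ENNReal.ofReal_ne_top,
    lintegral_lintegral_swap (Measurable.aemeasurable (by fun_prop))]
  simp_rw [lintegral_rpow_mul_exp_neg_norm_sq hk]
  rw [lintegral_const_mul' _ _ ENNReal.ofReal_ne_top, ← mul_assoc,
    ← ENNReal.ofReal_mul (by positivity)]

variable [FiniteDimensional ℝ V]

theorem charFun_conv_map_neg (ξ : V) :
    charFun (ν.conv (ν.map fun x => -x)) ξ = ((‖charFun ν ξ‖ ^ 2 : ℝ) : ℂ) := by
  have hneg : charFun (ν.map fun x => -x) ξ = starRingEnd ℂ (charFun ν ξ) := by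
    rw [← charFun_neg]
    simpa using charFun_map_smul (μ := ν) (-1 : ℝ) ξ
  rw [charFun_conv, hneg, Complex.mul_conj, Complex.normSq_eq_norm_sq]

theorem integrable_norm_charFun_mul_exp_neg_div {t : ℝ} (ht : 0 < t) :
    Integrable fun ξ => ‖charFun ν ξ‖ * Real.exp (-(‖ξ‖ ^ 2 / t)) := by
  refine ((integrable_exp_neg_norm_sq_div V ht).const_mul (ν.real univ)).mono'
    (Measurable.aestronglyMeasurable (by fun_prop)) (ae_of_all _ fun ξ => ?_)
  have := norm_charFun_le (μ := ν) ξ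
  rw [Real.norm_of_nonneg (by positivity)]
  gcongr

variable {ν} in
theorem lintegral_norm_charFun_mul_rpow_norm (hν : ∀ ξ, charFun ν ξ = ‖charFun ν ξ‖) {k : ℝ}
    (hk : 0 < k) (hkd : k < finrank ℝ V) :
    ENNReal.ofReal (Real.Gamma ((finrank ℝ V - k) / 2)) *
        ∫⁻ ξ, ENNReal.ofReal (‖charFun ν ξ‖ * ‖ξ‖ ^ (k - finrank ℝ V)) =
      ENNReal.ofReal (Real.pi ^ (finrank ℝ V / 2 : ℝ) * (2 ^ k * Real.Gamma (k / 2))) *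
        ∫⁻ y, ‖y‖ₑ ^ (-k) ∂ν := by
  have : Nontrivial V := nontrivial_of_finrank_pos (R := ℝ) (Nat.cast_pos.1 (hk.trans hkd))
  rw [← lintegral_rpow_mul_gaussianMean ν hk]
  set a : ℝ := (finrank ℝ V - k) / 2
  have ha : 0 < a := half_pos (sub_pos.2 hkd)
  have hslice (t : ℝ) (ht : t ∈ Ioi (0 : ℝ)) : ENNReal.ofReal (t ^ (-a - 1) * gaussianMean ν t) =
      ∫⁻ ξ, ENNReal.ofReal (‖charFun ν ξ‖ * (t ^ (-a - 1) * Real.exp (-(‖ξ‖ ^ 2 / t)))) := by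
    have ht0 : 0 < t := ht
    have hmean : gaussianMean ν t = ∫ ξ, ‖charFun ν ξ‖ * Real.exp (-(‖ξ‖ ^ 2 / t)) := by
      rw [← Complex.ofReal_inj, ← integral_charFun_mul_exp_neg_div ν ht0, ← integral_complex_ofReal]
      congr 1 with ξ
      rw [Complex.ofReal_mul, ← hν ξ]
    rw [hmean, ← integral_const_mul, ofReal_integral_eq_lintegral_ofReal
      ((integrable_norm_charFun_mul_exp_neg_div ν ht0).const_mul _)
      (ae_of_all _ fun ξ => by positivity)]
    simp_rw [mul_left_comm]
  have hfiber (ξ : V) (hξ : ξ ≠ 0) :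
      ∫⁻ t in Ioi (0 : ℝ),
          ENNReal.ofReal (‖charFun ν ξ‖ * (t ^ (-a - 1) * Real.exp (-(‖ξ‖ ^ 2 / t)))) =
        ENNReal.ofReal (Real.Gamma a) *
          ENNReal.ofReal (‖charFun ν ξ‖ * ‖ξ‖ ^ (k - finrank ℝ V)) := by
    have hr : 0 < ‖ξ‖ := norm_pos_iff.2 hξ
    rw [← ofReal_integral_eq_lintegral_ofReal
        ((integrableOn_rpow_mul_exp_neg_div ha (by positivity)).const_mul _) ?_,
      integral_const_mul, integral_rpow_mul_exp_neg_div ha (by positivity),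
      one_div_sq_rpow_half hr, neg_sub, ← ENNReal.ofReal_mul (Real.Gamma_pos_of_pos ha).le]
    · ring_nf
    · filter_upwards [ae_restrict_mem measurableSet_Ioi] with t ht
      have ht0 : 0 < t := ht
      positivity
  rw [← lintegral_const_mul _ (by fun_prop), setLIntegral_congr_fun measurableSet_Ioi hslice,
    lintegral_lintegral_swap (Measurable.aemeasurable (by fun_prop))]
  refine lintegral_congr_ae ?_
  filter_upwards [Measure.ae_ne volume (0 : V)] with ξ hξ using (hfiber ξ hξ).symm

theorem lintegral_norm_charFun_sq_mul_rpow_norm {s : ℝ} (hs : 0 < s) (hsd : s < finrank ℝ V) :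
    ENNReal.ofReal (Real.Gamma ((finrank ℝ V - s) / 2)) *
        ∫⁻ ξ, ENNReal.ofReal (‖charFun ν ξ‖ ^ 2 * ‖ξ‖ ^ (s - finrank ℝ V)) =
      ENNReal.ofReal (Real.pi ^ (finrank ℝ V / 2 : ℝ) * (2 ^ s * Real.Gamma (s / 2))) *
        ∫⁻ x, ∫⁻ y, edist x y ^ (-s) ∂ν ∂ν := by
  have h := lintegral_norm_charFun_mul_rpow_norm (ν := ν.conv (ν.map fun x => -x))
    (fun ξ => by simp [charFun_conv_map_neg]) hs hsd
  have henergy : ∫⁻ z, ‖z‖ₑ ^ (-s) ∂ν.conv (ν.map fun x => -x) =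
      ∫⁻ x, ∫⁻ y, edist x y ^ (-s) ∂ν ∂ν := by
    rw [Measure.lintegral_conv (by fun_prop)]
    refine lintegral_congr fun x => ?_
    rw [lintegral_map (by fun_prop) measurable_neg]
    simp_rw [edist_eq_enorm_sub, sub_eq_add_neg]
  simpa only [charFun_conv_map_neg, Complex.norm_real, norm_pow, norm_norm, henergy] using h

theorem integrable_norm_charFun_sq_mul_rpow_norm {s : ℝ} (hs : 0 < s) (hsd : s < finrank ℝ V)
    (hE : ∫⁻ x, ∫⁻ y, edist x y ^ (-s) ∂ν ∂ν < ⊤) :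
    Integrable fun ξ => ‖charFun ν ξ‖ ^ 2 * ‖ξ‖ ^ (s - finrank ℝ V) := by
  refine ⟨Measurable.aestronglyMeasurable (by fun_prop), ?_⟩
  have hGamma : ENNReal.ofReal (Real.Gamma ((finrank ℝ V - s) / 2)) ≠ 0 :=
    (ENNReal.ofReal_pos.2 (Real.Gamma_pos_of_pos (half_pos (sub_pos.2 hsd)))).ne'
  have hprod := ENNReal.mul_lt_top (ENNReal.ofReal_lt_top
    (r := Real.pi ^ (finrank ℝ V / 2 : ℝ) * (2 ^ s * Real.Gamma (s / 2)))) hE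
  rw [← lintegral_norm_charFun_sq_mul_rpow_norm ν hs hsd] at hprod
  rw [hasFiniteIntegral_iff_ofReal (ae_of_all _ fun ξ => by positivity)]
  exact ENNReal.lt_top_of_mul_ne_top_right hprod.ne hGamma

theorem integrable_rpow_norm_smul_charFun {s k : ℝ} (hk : 0 < k) (hks : 2 * k < s)
    (hsd : s < finrank ℝ V) (hE : ∫⁻ x, ∫⁻ y, edist x y ^ (-s) ∂ν ∂ν < ⊤) :
    Integrable fun ξ => ‖ξ‖ ^ (k - finrank ℝ V) • charFun ν ξ := by
  have : Nontrivial V := nontrivial_of_finrank_pos (R := ℝ)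
    (Nat.cast_pos.1 ((by linarith : 0 < s).trans hsd))
  set d := (finrank ℝ V : ℝ)
  have hmeas : Measurable fun ξ => ‖ξ‖ ^ (k - d) • charFun ν ξ := by fun_prop
  have hnorm (ξ : V) : ‖‖ξ‖ ^ (k - d) • charFun ν ξ‖ = ‖charFun ν ξ‖ * ‖ξ‖ ^ (k - d) := by
    rw [norm_smul, Real.norm_of_nonneg (by positivity), mul_comm]
  have hnear : IntegrableOn (fun ξ => ‖ξ‖ ^ (k - d) • charFun ν ξ) (ball 0 1) := by
    refine ((integrableOn_ball_norm_rpow volume (a := k - d) (by linarith)).const_mul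
      (ν.real univ)).mono' hmeas.aestronglyMeasurable (ae_of_all _ fun ξ => ?_)
    rw [hnorm]
    gcongr
    exact norm_charFun_le ξ
  have hfar : IntegrableOn (fun ξ => ‖ξ‖ ^ (k - d) • charFun ν ξ) (ball 0 1)ᶜ := by
    refine ((integrable_norm_charFun_sq_mul_rpow_norm ν (by linarith) hsd hE).integrableOn.add
      (integrableOn_compl_ball_norm_rpow volume (a := 2 * k - d - s) (by linarith))).mono'
      hmeas.aestronglyMeasurable ?_
    filter_upwards [ae_restrict_mem measurableSet_ball.compl] with ξ hξ
    have hr : 0 < ‖ξ‖ := zero_lt_one.trans_le (by simpa using hξ)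
    rw [hnorm, show k - d = ((s - d) + (2 * k - d - s)) / 2 by ring]
    exact mul_rpow_add_half_le hr _ _ _
  rw [← integrableOn_univ, ← union_compl_self (ball (0 : V) 1)]
  exact hnear.union hfar

theorem integral_rpow_mul_exp_smul_charFun {t : ℝ} (ht : 0 < t) (b : ℝ) :
    ∫ ξ, (t ^ b * Real.exp (-(‖ξ‖ ^ 2 / t))) • charFun ν ξ =
      ((t ^ b * gaussianMean ν t : ℝ) : ℂ) := by
  simp_rw [mul_smul, Complex.real_smul]
  rw [integral_const_mul, Complex.ofReal_mul, ← integral_charFun_mul_exp_neg_div ν ht]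
  simp_rw [mul_comm]

variable {ν} [Nontrivial V] {k : ℝ}

theorem integrable_rpow_mul_exp_smul_charFun (hkd : k < finrank ℝ V)
    (hint : Integrable fun ξ => ‖ξ‖ ^ (k - finrank ℝ V) • charFun ν ξ) :
    Integrable (Function.uncurry fun ξ (t : ℝ) =>
      (t ^ (-((finrank ℝ V - k) / 2) - 1) * Real.exp (-(‖ξ‖ ^ 2 / t))) • charFun ν ξ)
      (volume.prod (volume.restrict (Ioi 0))) := by
  set a := (finrank ℝ V - k) / 2
  have ha : 0 < a := half_pos (sub_pos.2 hkd)
  rw [integrable_prod_iff (Measurable.aestronglyMeasurable (by fun_prop))]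
  constructor
  · filter_upwards [Measure.ae_ne volume (0 : V)] with ξ hξ
    simp only [Function.uncurry]
    exact Integrable.smul_const (integrableOn_rpow_mul_exp_neg_div ha (by positivity)) _
  · refine (hint.norm.const_mul (Real.Gamma a)).congr ?_
    filter_upwards [Measure.ae_ne volume (0 : V)] with ξ hξ
    have hr : 0 < ‖ξ‖ := norm_pos_iff.2 hξ
    have hnorm (t : ℝ) (ht : t ∈ Ioi (0 : ℝ)) :
        ‖(t ^ (-a - 1) * Real.exp (-(‖ξ‖ ^ 2 / t))) • charFun ν ξ‖ =
          t ^ (-a - 1) * Real.exp (-(‖ξ‖ ^ 2 / t)) * ‖charFun ν ξ‖ := by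
      have ht0 : 0 < t := ht
      rw [norm_smul, Real.norm_of_nonneg (by positivity)]
    simp only [Function.uncurry]
    rw [setIntegral_congr_fun measurableSet_Ioi hnorm, integral_mul_const,
      integral_rpow_mul_exp_neg_div ha (by positivity), one_div_sq_rpow_half hr, neg_sub,
      norm_smul, Real.norm_of_nonneg (by positivity)]
    ring

theorem integrableOn_rpow_mul_gaussianMean (hkd : k < finrank ℝ V)
    (hint : Integrable fun ξ => ‖ξ‖ ^ (k - finrank ℝ V) • charFun ν ξ) :
    IntegrableOn (fun t => t ^ (-((finrank ℝ V - k) / 2) - 1) * gaussianMean ν t) (Ioi 0) := by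
  refine (integrable_rpow_mul_exp_smul_charFun hkd hint).integral_prod_right.re.congr ?_
  filter_upwards [ae_restrict_mem measurableSet_Ioi] with t ht
  simp only [Function.uncurry]
  rw [integral_rpow_mul_exp_smul_charFun ν ht, RCLike.re_eq_complex_re, Complex.ofReal_re]

theorem Gamma_smul_integral_rpow_norm_smul_charFun (hkd : k < finrank ℝ V)
    (hint : Integrable fun ξ => ‖ξ‖ ^ (k - finrank ℝ V) • charFun ν ξ) :
    Real.Gamma ((finrank ℝ V - k) / 2) • ∫ ξ, ‖ξ‖ ^ (k - finrank ℝ V) • charFun ν ξ =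
      ((∫ t in Ioi (0 : ℝ), t ^ (-((finrank ℝ V - k) / 2) - 1) * gaussianMean ν t : ℝ) : ℂ) := by
  have hprod := integrable_rpow_mul_exp_smul_charFun hkd hint
  set a := (finrank ℝ V - k) / 2
  have ha : 0 < a := half_pos (sub_pos.2 hkd)
  have hfiber (ξ : V) (hξ : ξ ≠ 0) :
      ∫ t in Ioi (0 : ℝ), (t ^ (-a - 1) * Real.exp (-(‖ξ‖ ^ 2 / t))) • charFun ν ξ =
        Real.Gamma a • ‖ξ‖ ^ (k - finrank ℝ V) • charFun ν ξ := by
    have hr : 0 < ‖ξ‖ := norm_pos_iff.2 hξ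
    rw [integral_smul_const, integral_rpow_mul_exp_neg_div ha (by positivity),
      one_div_sq_rpow_half hr, neg_sub, mul_comm, mul_smul]
  calc
    _ = ∫ ξ, ∫ t in Ioi (0 : ℝ),
          (t ^ (-a - 1) * Real.exp (-(‖ξ‖ ^ 2 / t))) • charFun ν ξ := by
      rw [← integral_smul]
      refine integral_congr_ae ?_
      filter_upwards [Measure.ae_ne volume (0 : V)] with ξ hξ using (hfiber ξ hξ).symm
    _ = ∫ t in Ioi (0 : ℝ), ((t ^ (-a - 1) * gaussianMean ν t : ℝ) : ℂ) := by
      rw [integral_integral_swap hprod]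
      exact setIntegral_congr_fun measurableSet_Ioi fun t ht =>
        integral_rpow_mul_exp_smul_charFun ν ht _
    _ = _ := integral_complex_ofReal

theorem integral_rpow_norm_smul_charFun_ne_zero [NeZero ν] (hkd : k < finrank ℝ V)
    (hint : Integrable fun ξ => ‖ξ‖ ^ (k - finrank ℝ V) • charFun ν ξ) :
    ∫ ξ, ‖ξ‖ ^ (k - finrank ℝ V) • charFun ν ξ ≠ 0 := by
  have hpos (t : ℝ) (ht : t ∈ Ioi (0 : ℝ)) :
      0 < t ^ (-((finrank ℝ V - k) / 2) - 1) * gaussianMean ν t :=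
    mul_pos (Real.rpow_pos_of_pos ht _) (gaussianMean_pos ν ht)
  have hint_pos : 0 <
      ∫ t in Ioi (0 : ℝ), t ^ (-((finrank ℝ V - k) / 2) - 1) * gaussianMean ν t := by
    rw [setIntegral_pos_iff_support_of_nonneg_ae
      ((ae_restrict_mem measurableSet_Ioi).mono fun t ht => (hpos t ht).le)
      (integrableOn_rpow_mul_gaussianMean hkd hint)]
    exact (by simp : 0 < volume (Ioi (0 : ℝ))).trans_le
      (measure_mono fun t ht => ⟨(hpos t ht).ne', ht⟩)
  intro hzero
  have h := Gamma_smul_integral_rpow_norm_smul_charFun hkd hint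
  rw [hzero, smul_zero] at h
  exact hint_pos.ne (by exact_mod_cast h)

end RieszKernel

section Rotation

variable {n : ℕ}

instance isHaarMeasure_haarO : (haarO n).IsHaarMeasure := by
  unfold haarO
  infer_instance

instance isMulRightInvariant_haarO : (haarO n).IsMulRightInvariant where
  map_mul_right_eq_self k := by
    have : IsProbabilityMeasure ((haarO n).map (· * k)) :=
      Measure.isProbabilityMeasure_map (measurable_mul_const k).aemeasurable
    exact Measure.isHaarMeasure_eq_of_isProbabilityMeasure _ _

/-- The orthogonal group `O(n)`, encoded by matrices, as the group of linear isometries of `ℝⁿ`. -/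
noncomputable def act : O n ≃* (E n ≃ₗᵢ[ℝ] E n) :=
  (Unitary.mapEquiv { __ := Matrix.toEuclideanCLM (n := Fin n) (𝕜 := ℝ) }).toMulEquiv.trans
    Unitary.linearIsometryEquiv

theorem continuous_act : Continuous fun p : O n × E n => act p.1 p.2 := by
  change Continuous fun p : O n × E n => WithLp.toLp 2 (p.1.1.mulVec p.2.ofLp)
  fun_prop

theorem exists_act_eq {x y : E n} (h : ‖x‖ = ‖y‖) : ∃ g : O n, act g x = y :=
  ⟨act.symm (ℝ ∙ (x - y))ᗮ.reflection, by
    rw [MulEquiv.apply_symm_apply, Submodule.reflection_sub h]⟩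

theorem lintegral_act_eq_of_norm_eq (f : E n → ENNReal) {x y : E n} (h : ‖x‖ = ‖y‖) :
    ∫⁻ g, f (act g x) ∂haarO n = ∫⁻ g, f (act g y) ∂haarO n := by
  obtain ⟨k, rfl⟩ := exists_act_eq h
  simpa only [map_mul, LinearIsometryEquiv.coe_mul, Function.comp_apply] using
    (lintegral_mul_right_eq_self (μ := haarO n) (fun g => f (act g x)) k).symm

section SphereMean

variable [NeZero n]

/-- The mean of `f` over the sphere of radius `r` centred at the origin of `ℝⁿ`, taken as a mean
over `O(n)` of the values of `f` on the orbit of `r e₁`. -/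
noncomputable def sphereMean (f : E n → ENNReal) (r : ℝ) : ENNReal :=
  ∫⁻ g, f (act g (r • EuclideanSpace.single 0 1)) ∂haarO n

variable {f : E n → ENNReal}

theorem measurable_sphereMean (hf : Measurable f) : Measurable (sphereMean f) := by
  have hact : Continuous fun p : ℝ × O n => act p.2 (p.1 • EuclideanSpace.single 0 1) :=
    continuous_act.comp (f := fun p : ℝ × O n => (p.2, p.1 • EuclideanSpace.single 0 1))
      (by fun_prop)
  exact (hf.comp hact.measurable).lintegral_prod_right'

theorem lintegral_act_eq_sphereMean (f : E n → ENNReal) (x : E n) :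
    ∫⁻ g, f (act g x) ∂haarO n = sphereMean f ‖x‖ :=
  lintegral_act_eq_of_norm_eq f (by simp [norm_smul])

theorem lintegral_norm_mul_eq_lintegral_sphereMean (hf : Measurable f) {w : ℝ → ENNReal}
    (hw : Measurable w) : ∫⁻ ξ, w ‖ξ‖ * f ξ = ∫⁻ ξ : E n, w ‖ξ‖ * sphereMean f ‖ξ‖ := by
  have hrot (g : O n) : ∫⁻ ξ, w ‖ξ‖ * f (act g ξ) = ∫⁻ ξ, w ‖ξ‖ * f ξ := by
    simpa only [LinearIsometryEquiv.norm_map] using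
      (act g).measurePreserving.lintegral_comp (f := fun ξ => w ‖ξ‖ * f ξ) (by fun_prop)
  have hmean (ξ : E n) : ∫⁻ g, w ‖ξ‖ * f (act g ξ) ∂haarO n = w ‖ξ‖ * sphereMean f ‖ξ‖ := by
    have hact : Continuous fun g : O n => act g ξ :=
      continuous_act.comp (f := fun g : O n => (g, ξ)) (by fun_prop)
    rw [lintegral_const_mul _ (by fun_prop), lintegral_act_eq_sphereMean]
  have hmeas : Measurable fun p : O n × E n => w ‖p.2‖ * f (act p.1 p.2) :=
    (hw.comp measurable_snd.norm).mul (hf.comp continuous_act.measurable)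
  have hswap := lintegral_lintegral_swap (μ := haarO n) (ν := volume)
    (f := fun g ξ => w ‖ξ‖ * f (act g ξ)) hmeas.aemeasurable
  simpa only [hrot, hmean, lintegral_const, measure_univ, mul_one] using hswap

end SphereMean

section Subspace

variable {F : Type*} [NormedAddCommGroup F] [InnerProductSpace ℝ F] [FiniteDimensional ℝ F]
  [MeasurableSpace F] [BorelSpace F] (ι : F →ₗᵢ[ℝ] E n)

theorem measurable_act_comp : Measurable fun p : O n × F => act p.1 (ι p.2) :=
  (continuous_act.comp (f := fun p : O n × F => (p.1, ι p.2)) (by fun_prop)).measurable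

theorem lintegral_lintegral_act_eq [NeZero n] [Nontrivial F] {f : E n → ENNReal}
    (hf : Measurable f) :
    ∫⁻ g, (∫⁻ u, f (act g (ι u))) ∂haarO n = (volume : Measure F).toSphere univ *
      ∫⁻ r in Ioi (0 : ℝ), ENNReal.ofReal (r ^ (finrank ℝ F - 1)) * sphereMean f r := by
  rw [lintegral_lintegral_swap (f := fun g u => f (act g (ι u)))
    (hf.comp (measurable_act_comp ι)).aemeasurable]
  simp_rw [lintegral_act_eq_sphereMean, ι.norm_map]
  exact lintegral_comp_norm volume (measurable_sphereMean hf)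

theorem toSphere_mul_lintegral_lintegral_act [Nontrivial F] {f : E n → ENNReal}
    (hf : Measurable f) :
    (volume : Measure (E n)).toSphere univ * ∫⁻ g, (∫⁻ u, f (act g (ι u))) ∂haarO n =
      (volume : Measure F).toSphere univ *
        ∫⁻ ξ, ENNReal.ofReal (‖ξ‖ ^ (finrank ℝ F - n : ℝ)) * f ξ := by
  have hF : 0 < finrank ℝ F := finrank_pos
  have hFn : finrank ℝ F ≤ n := by
    simpa using LinearMap.finrank_le_finrank_of_injective (f := ι.toLinearMap) ι.injective
  have : NeZero n := ⟨(hF.trans_le hFn).ne'⟩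
  have hmean := measurable_sphereMean hf
  rw [lintegral_lintegral_act_eq ι hf, lintegral_norm_mul_eq_lintegral_sphereMean hf
    (w := fun r => ENNReal.ofReal (r ^ (finrank ℝ F - n : ℝ))) (by fun_prop),
    lintegral_comp_norm (V := E n) volume
      (f := fun r => ENNReal.ofReal (r ^ (finrank ℝ F - n : ℝ)) * sphereMean f r) (by fun_prop),
    mul_left_comm, finrank_euclideanSpace_fin]
  congr 2
  refine setLIntegral_congr_fun measurableSet_Ioi fun r hr => ?_
  have hr0 : 0 < r := hr
  rw [← mul_assoc, ← ENNReal.ofReal_mul (by positivity), ← Real.rpow_natCast,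
    ← Real.rpow_natCast, ← Real.rpow_add hr0, Nat.cast_sub hF, Nat.cast_sub (hF.trans_le hFn)]
  ring_nf

theorem toSphere_smul_map_act [Nontrivial F] :
    (volume : Measure (E n)).toSphere univ •
        ((haarO n).prod volume).map (fun p : O n × F => act p.1 (ι p.2)) =
      (volume : Measure F).toSphere univ •
        volume.withDensity fun ξ => ((‖ξ‖ ^ (finrank ℝ F - n : ℝ)).toNNReal : ENNReal) := by
  have hact := measurable_act_comp ι
  refine Measure.ext_of_lintegral _ fun f hf => ?_
  rw [lintegral_smul_measure, lintegral_smul_measure, lintegral_map hf hact,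
    lintegral_prod (fun p => f (act p.1 (ι p.2))) (hf.comp hact).aemeasurable,
    lintegral_withDensity_eq_lintegral_mul _ (by fun_prop) hf]
  exact toSphere_mul_lintegral_lintegral_act ι hf

end Subspace

end Rotation

section Projection

variable {F V : Type*} [NormedAddCommGroup F] [InnerProductSpace ℝ F] [FiniteDimensional ℝ F]
  [NormedAddCommGroup V] [InnerProductSpace ℝ V] [FiniteDimensional ℝ V] (T : F →ₗᵢ[ℝ] V)

open ContinuousLinearMap (adjoint adjoint_inner_left)

theorem orthogonalProjectionOnto_range_eq (x : V) :
    (LinearMap.range T.toLinearMap).orthogonalProjectionOnto x =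
      T.equivRange (adjoint T.toContinuousLinearMap x) := by
  refine Subtype.ext (Submodule.eq_starProjection_of_mem_of_inner_eq_zero
    (T.equivRange (adjoint T.toContinuousLinearMap x)).2 ?_)
  rintro _ ⟨w, rfl⟩
  change inner ℝ (x - T (adjoint T.toContinuousLinearMap x)) (T w) = 0
  rw [inner_sub_left, T.inner_map_map, adjoint_inner_left]
  exact sub_self _

theorem zero_mem_interior_orthogonalProjectionOnto_image_iff {S : Set V} :
    0 ∈ interior ((LinearMap.range T.toLinearMap).orthogonalProjectionOnto '' S) ↔
      0 ∈ interior (adjoint T.toContinuousLinearMap '' S) := by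
  have himage : (LinearMap.range T.toLinearMap).orthogonalProjectionOnto '' S =
      T.equivRange.toHomeomorph '' (adjoint T.toContinuousLinearMap '' S) := by
    rw [image_image]
    exact image_congr fun x _ => orthogonalProjectionOnto_range_eq T x
  rw [himage, ← Homeomorph.image_interior]
  constructor
  · rintro ⟨u, hu, hu0⟩
    rwa [(map_eq_zero_iff T.equivRange T.equivRange.injective).1 hu0] at hu
  · exact fun h => ⟨0, h, map_zero T.equivRange⟩

variable [MeasurableSpace F] [BorelSpace F] [MeasurableSpace V] [BorelSpace V] (μ : Measure V)

theorem charFun_map_adjoint (A : F →L[ℝ] V) (u : F) :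
    charFun (μ.map (adjoint A)) u = charFun μ (A u) := by
  rw [charFun_apply, charFun_apply,
    integral_map (by fun_prop) (Measurable.aestronglyMeasurable (by fun_prop))]
  simp_rw [adjoint_inner_left]

variable {μ} in
theorem zero_mem_interior_orthogonalProjectionOnto_support [IsFiniteMeasure μ]
    (hμ : IsCompact μ.support) (hint : Integrable fun u => charFun μ (T u))
    (hne : ∫ u, charFun μ (T u) ≠ 0) :
    0 ∈ interior ((LinearMap.range T.toLinearMap).orthogonalProjectionOnto '' μ.support) := by
  set A := adjoint T.toContinuousLinearMap
  have hcharFun : charFun (μ.map A) = fun u => charFun μ (T u) :=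
    funext (charFun_map_adjoint μ T.toContinuousLinearMap)
  have hK : IsClosed (A '' μ.support) := (hμ.image A.continuous).isClosed
  have hnull : μ.map A (A '' μ.support)ᶜ = 0 := by
    rw [Measure.map_apply A.continuous.measurable hK.measurableSet.compl, preimage_compl]
    exact measure_mono_null (compl_subset_compl.2 (subset_preimage_image A μ.support))
      Measure.measure_compl_support
  exact (zero_mem_interior_orthogonalProjectionOnto_image_iff T).2
    (zero_mem_interior_of_integral_charFun_ne_zero (hcharFun ▸ hint) (hcharFun ▸ hne) hK hnull)

end Projection

section RandomSubspace

variable {n : ℕ} {F : Type*} [NormedAddCommGroup F] [InnerProductSpace ℝ F]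
  [FiniteDimensional ℝ F] [MeasurableSpace F] [BorelSpace F] [Nontrivial F] (ι : F →ₗᵢ[ℝ] E n)

section Polar

variable {f : E n → ℂ}

theorem rpow_norm_toNNReal_smul (a : ℝ) (ξ : E n) (z : ℂ) :
    (‖ξ‖ ^ a).toNNReal • z = ‖ξ‖ ^ a • z := by
  rw [NNReal.smul_def, Real.coe_toNNReal _ (by positivity)]

theorem integrable_comp_act_iff (hf : Measurable f) :
    Integrable (fun p : O n × F => f (act p.1 (ι p.2))) ((haarO n).prod volume) ↔
      Integrable fun ξ => ‖ξ‖ ^ (finrank ℝ F - n : ℝ) • f ξ := by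
  have : Nontrivial (E n) := ι.injective.nontrivial
  have hdensity : Measurable fun ξ : E n => (‖ξ‖ ^ (finrank ℝ F - n : ℝ)).toNNReal := by fun_prop
  calc
    _ ↔ Integrable f (((haarO n).prod volume).map fun p : O n × F => act p.1 (ι p.2)) :=
      (integrable_map_measure hf.aestronglyMeasurable
        (measurable_act_comp ι).aemeasurable).symm
    _ ↔ Integrable f (volume.withDensity fun ξ =>
          ((‖ξ‖ ^ (finrank ℝ F - n : ℝ)).toNNReal : ENNReal)) := by
      rw [← integrable_smul_measure (toSphere_univ_ne_zero (volume : Measure (E n)))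
        (measure_ne_top _ _), toSphere_smul_map_act,
        integrable_smul_measure (toSphere_univ_ne_zero _) (measure_ne_top _ _)]
    _ ↔ _ := by
      simp_rw [integrable_withDensity_iff_integrable_smul hdensity, rpow_norm_toNNReal_smul]

theorem toSphere_smul_integral_comp_act (hf : Measurable f) :
    (volume : Measure (E n)).toSphere.real univ •
        ∫ p : O n × F, f (act p.1 (ι p.2)) ∂(haarO n).prod volume =
      (volume : Measure F).toSphere.real univ •
        ∫ ξ, ‖ξ‖ ^ (finrank ℝ F - n : ℝ) • f ξ := by
  have hdensity : Measurable fun ξ : E n => (‖ξ‖ ^ (finrank ℝ F - n : ℝ)).toNNReal := by fun_prop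
  rw [← integral_map (measurable_act_comp ι).aemeasurable hf.aestronglyMeasurable, Measure.real,
    ← integral_smul_measure, toSphere_smul_map_act, integral_smul_measure,
    integral_withDensity_eq_integral_smul hdensity]
  simp_rw [rpow_norm_toNNReal_smul]
  rfl

end Polar

variable {μ : Measure (E n)} [IsFiniteMeasure μ] {s : ℝ}

theorem integrable_charFun_act (hFs : 2 * (finrank ℝ F : ℝ) < s) (hsn : s < n)
    (hE : energy s μ < ⊤) :
    Integrable (fun p : O n × F => charFun μ (act p.1 (ι p.2))) ((haarO n).prod volume) := by
  have hF : (0 : ℝ) < finrank ℝ F := Nat.cast_pos.2 finrank_pos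
  have hkernel :=
    integrable_rpow_norm_smul_charFun μ hF hFs (by rwa [finrank_euclideanSpace_fin]) hE
  rw [finrank_euclideanSpace_fin] at hkernel
  exact (integrable_comp_act_iff ι measurable_charFun).2 hkernel

theorem integral_charFun_act_ne_zero [NeZero μ] (hFs : 2 * (finrank ℝ F : ℝ) < s) (hsn : s < n)
    (hE : energy s μ < ⊤) :
    ∫ p : O n × F, charFun μ (act p.1 (ι p.2)) ∂(haarO n).prod volume ≠ 0 := by
  have : Nontrivial (E n) := ι.injective.nontrivial
  have hF : (0 : ℝ) < finrank ℝ F := Nat.cast_pos.2 finrank_pos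
  have hsn' : s < finrank ℝ (E n) := by rwa [finrank_euclideanSpace_fin]
  have hkernel := integral_rpow_norm_smul_charFun_ne_zero (ν := μ) (by linarith)
    (integrable_rpow_norm_smul_charFun μ hF hFs hsn' hE)
  rw [finrank_euclideanSpace_fin] at hkernel
  intro h0
  have hpolar := toSphere_smul_integral_comp_act ι (measurable_charFun (μ := μ))
  rw [h0, smul_zero] at hpolar
  exact smul_ne_zero ((measureReal_ne_zero_iff (measure_ne_top _ _)).2 (toSphere_univ_ne_zero _))
    hkernel hpolar.symm

variable {ι} in
theorem measure_zero_mem_interior_range_act_pos [NeZero μ] (hμ : IsCompact μ.support)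
    (hFs : 2 * (finrank ℝ F : ℝ) < s) (hsn : s < n) (hE : energy s μ < ⊤) :
    0 < haarO n {g | 0 ∈ interior ((LinearMap.range ((act g).toLinearIsometry.comp
      ι).toLinearMap).orthogonalProjectionOnto '' μ.support)} := by
  have hint := integrable_charFun_act ι hFs hsn hE
  refine pos_iff_ne_zero.2 fun hnull => integral_charFun_act_ne_zero ι hFs hsn hE ?_
  rw [integral_prod _ hint]
  refine integral_eq_zero_of_ae ?_
  filter_upwards [measure_eq_zero_iff_ae_notMem.1 hnull, hint.prod_right_ae] with g hg hgint
  by_contra hne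
  exact hg (zero_mem_interior_orthogonalProjectionOnto_support _ hμ hgint hne)

end RandomSubspace

section Grassmannian

variable {n m : ℕ}

theorem range_act_comp_subtype (g : O n) (W : Gr n m) :
    LinearMap.range ((act g).toLinearIsometry.comp W.1.subtypeₗᵢ).toLinearMap =
      (Gr.rotate g W).1 := by
  change LinearMap.range ((act g).toLinearIsometry.toLinearMap ∘ₗ W.1.subtype) = _
  rw [LinearMap.range_comp, Submodule.range_subtype]
  rfl

theorem zero_mem_interior_orthogonalProjectionOnto_of_finrank_eq_zero (W : Gr n 0) {S : Set (E n)}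
    (hS : S.Nonempty) : 0 ∈ interior (W.1.orthogonalProjectionOnto '' S) := by
  have : Subsingleton W.1 := finrank_zero_iff.1 W.2
  rw [(hS.image _).eq_univ, interior_univ]
  exact mem_univ 0

variable {s : ℝ} {μ : Measure (E n)}

theorem gammaGr_zero_mem_interior_pos_of_isCompact_support [IsFiniteMeasure μ] [NeZero μ]
    (hμ : IsCompact μ.support) (hms : 2 * (m : ℝ) < s) (hsn : s < n) (hE : energy s μ < ⊤) :
    0 < gammaGr n m {W | 0 ∈ interior (W.1.orthogonalProjectionOnto '' μ.support)} := by
  have hmn : m ≤ n := by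
    have : (0 : ℝ) ≤ m := Nat.cast_nonneg m
    exact_mod_cast (by linarith : (m : ℝ) ≤ n)
  obtain rfl | hm := m.eq_zero_or_pos
  · have := isProbabilityMeasure_gammaGr hmn
    have huniv : {W : Gr n 0 | 0 ∈ interior (W.1.orthogonalProjectionOnto '' μ.support)} = univ :=
      eq_univ_of_forall fun W => zero_mem_interior_orthogonalProjectionOnto_of_finrank_eq_zero W
        (Measure.nonempty_support (NeZero.ne μ))
    rw [huniv, measure_univ]
    exact one_pos
  · have hbase : finrank ℝ (Gr.base hmn).1 = m := (Gr.base hmn).2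
    have : Nontrivial (Gr.base hmn).1 := nontrivial_of_finrank_pos (R := ℝ) (by rwa [hbase])
    rw [gammaGr, dif_pos hmn]
    refine ((measure_zero_mem_interior_range_act_pos (ι := (Gr.base hmn).1.subtypeₗᵢ) hμ
      (by rwa [hbase]) hsn hE).trans_le (measure_mono fun g hg => ?_)).trans_le
      (Measure.le_map_apply (Gr.continuous_rotate _).measurable.aemeasurable _)
    rwa [mem_preimage, mem_ofPred_eq, ← range_act_comp_subtype]

end Grassmannian

section LocallyFinite

variable {n : ℕ} {s : ℝ} {μ : Measure (E n)}

theorem energy_restrict_le (s : ℝ) (μ : Measure (E n)) (K : Set (E n)) :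
    energy s (μ.restrict K) ≤ energy s μ :=
  (setLIntegral_le_lintegral K _).trans
    (lintegral_mono fun _ => setLIntegral_le_lintegral K _)

theorem measure_closedBall_lt_top_of_lintegral_edist_rpow_lt_top (hs : 0 ≤ s) {x : E n}
    (hx : ∫⁻ y, edist x y ^ (-s) ∂μ < ⊤) {R : ℝ} (hR : 0 < R) : μ (closedBall x R) < ⊤ := by
  have hR' : 0 < ENNReal.ofReal R := ENNReal.ofReal_pos.2 hR
  have hsub : closedBall x R ⊆ {y | ENNReal.ofReal R ^ (-s) ≤ edist x y ^ (-s)} := by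
    intro y hy
    have hxy : edist x y ≤ ENNReal.ofReal R := by
      rw [edist_dist, dist_comm]
      exact ENNReal.ofReal_le_ofReal hy
    simp only [mem_ofPred_eq, ENNReal.rpow_neg]
    exact ENNReal.inv_le_inv.2 (ENNReal.rpow_le_rpow hxy hs)
  exact (measure_mono hsub).trans_lt ((meas_ge_le_lintegral_div (by fun_prop)
    (ENNReal.rpow_pos hR' ENNReal.ofReal_ne_top).ne'
    (ENNReal.rpow_ne_top_of_ne_zero hR'.ne' ENNReal.ofReal_ne_top)).trans_lt
    (ENNReal.div_lt_top hx.ne (ENNReal.rpow_pos hR' ENNReal.ofReal_ne_top).ne'))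

theorem isFiniteMeasureOnCompacts_of_energy_lt_top (hs : 0 ≤ s) (hE : energy s μ < ⊤) :
    IsFiniteMeasureOnCompacts μ := by
  obtain rfl | hμ := eq_or_ne μ 0
  · infer_instance
  obtain ⟨x, hx⟩ : ∃ x, ∫⁻ y, edist x y ^ (-s) ∂μ < ⊤ := by
    by_contra! hall
    have htop : energy s μ = ⊤ := by
      simp_rw [energy, top_unique (hall _)]
      rw [lintegral_const, ENNReal.top_mul (Measure.measure_univ_ne_zero.2 hμ)]
    exact hE.ne htop
  refine ⟨fun K hK => ?_⟩
  obtain ⟨R, hR, hKR⟩ := hK.isBounded.subset_closedBall_lt 0 x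
  exact (measure_mono hKR).trans_lt
    (measure_closedBall_lt_top_of_lintegral_edist_rpow_lt_top hs hx hR)

end LocallyFinite

end RieszProj

theorem mainTheorem7_general (n m : ℕ) (s : ℝ) (hms : 2 * (m : ℝ) < s) (hsn : s < (n : ℝ))
    (μ : MeasureTheory.Measure (EuclideanSpace ℝ (Fin n))) (hμ : μ ≠ 0)
    (hμ_energy : RieszProj.energy s μ < ⊤) :
    0 < RieszProj.gammaGr n m {V : RieszProj.Gr n m |
      (0 : V.1) ∈ interior (V.1.orthogonalProjectionOnto '' μ.support)} := by
  have hs : 0 ≤ s := by linarith [(Nat.cast_nonneg m : (0 : ℝ) ≤ m)]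
  have := RieszProj.isFiniteMeasureOnCompacts_of_energy_lt_top hs hμ_energy
  obtain ⟨x, hx⟩ := Measure.nonempty_support hμ
  let K := Metric.closedBall x 1
  have hK : IsCompact K := isCompact_closedBall x 1
  have hsupport : (μ.restrict K).support ⊆ K ∩ μ.support := by
    simpa only [hK.isClosed.closure_eq] using
      Measure.support_restrict_subset (μ := μ) (s := K)
  have : IsFiniteMeasure (μ.restrict K) := isFiniteMeasure_restrict.2 hK.measure_ne_top
  have : NeZero (μ.restrict K) := ⟨Measure.restrict_eq_zero.not.2
    ((Measure.mem_support_iff_forall x).1 hx K (Metric.closedBall_mem_nhds x one_pos)).ne'⟩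
  have hcompact : IsCompact (μ.restrict K).support :=
    hK.of_isClosed_subset Measure.isClosed_support (hsupport.trans Set.inter_subset_left)
  have hpos := RieszProj.gammaGr_zero_mem_interior_pos_of_isCompact_support hcompact hms hsn
    ((RieszProj.energy_restrict_le s μ K).trans_lt hμ_energy)
  refine hpos.trans_le (measure_mono fun V hV => ?_)
  exact interior_mono (Set.image_mono (hsupport.trans Set.inter_subset_right)) hV

theorem mainTheorem7 (n m : ℕ) (s : ℝ) (hms : 2 * (m : ℝ) < s) (hsn : s < (n : ℝ))
    (μ : MeasureTheory.Measure (EuclideanSpace ℝ (Fin n)))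
    (hμ_pos : 0 < μ Set.univ) (hμ_fin : μ Set.univ < ⊤) (hμ_supp : IsCompact μ.support)
    (hμ_energy : RieszProj.energy s μ < ⊤) :
    0 < RieszProj.gammaGr n m {V : RieszProj.Gr n m |
      (0 : V.1) ∈ interior (V.1.orthogonalProjectionOnto '' μ.support)} :=
  mainTheorem7_general n m s hms hsn μ (Measure.measure_univ_ne_zero.1 hμ_pos.ne') hμ_energy
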